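/- **Theorem 3.1.** Let $f:\mathbb R\to\mathbb R$ be of class $C^2$ and $h>0$. A *front-tracking approximation* (with parameter $h$) of $\partial_t u+\partial_x f(u)=0$ is a function $u(x,t)$, $x\in\mathbb R$, $t\ge 0$, right-continuous in $x$, for which there are finitely many times $0=T_0<T_1<\dots<T_N$ such that, on each of $[T_0,T_1],\dots,[T_{N-1},T_N],[T_N,\infty)$, $u$ is piecewise constant with finitely many jumps, which travel along straight lines (fronts) not meeting in the interior of the time interval, and such that: * every front satisfies the Rankine–Hugoniot relation $\sigma\,(u_+-u_-)=f(u_+)-f(u_-)$, where $\sigma$ is its speed and $u_-\ne u_+$ are its left and right states; * every front is either a Lax shock, i.e. it satisfies the Oleinik inequalities $\frac{f(w)-f(u_-)}{w-u_-}\ge\frac{f(u_+)-f(u_-)}{u_+-u_-}$ for all $w$ strictly between $u_-$ and $u_+$, or it is small: $|u_+-u_-|\le h$ (rarefaction front); * the fronts that issue from one point at a time $T_k$ form a monotone fan: their jumps $u_+-u_-$ all have the same sign. Let $u^{I,h}$ and $u^{II,h}$ be two front-tracking approximations with parameter $h$, and put $$a^h(x,t)=\frac{f(u^{II,h}(x,t))-f(u^{I,h}(x,t))}{u^{II,h}(x,t)-u^{I,h}(x,t)}\quad\bigl(=f'(u^{I,h}(x,t))\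 \text{where } u^{I,h}(x,t)=u^{II,h}(x,t)\bigr).$$ Let $\mathcal L(a^h)$ be the set of Lax discontinuities of $a^h$: the points $(x,t)$, $t>0$, near which $a^h$ takes exactly two constant values, separated by a straight line through $(x,t)$ of speed $\lambda^{a^h}(x,t)$, and at which $a^h(x-,t)>\lambda^{a^h}(x,t)>a^h(x+,t)$. Let $\|f''\|_\infty$ be the supremum of $|f''|$ over any fixed convex set $C\subseteq\mathbb R$ (for instance $C=\mathbb R$) that contains all values of $u^{I,h}$ and $u^{II,h}$. Then for all $0\le s\le t$ $$\begin{aligned}&\|u^{II,h}(t)-u^{I,h}(t)\|_{L^1(\mathbb R)}+\int_s^t\sum_{(x,\tau)\in\mathcal L(a^h)}2\,\bigl(a^h(x-,\tau)-\lambda^{a^h}(x,\tau)\bigr)\,\bigl|u^{II,h}(x-,\tau)-u^{I,h}(x-,\tau)\bigr|\,d\tau\\&\qquad\le\ \|u^{II,h}(s)-u^{I,h}(s)\|_{L^1(\mathbb R)}+2h\,(t-s)\,\|f''\|_\infty\,\Bigl(TV(u^{I,h}(0))+TV(u^{II,h}(0))\Bigr).\end{aligned}$$ Here all terms are in $[0,\infty]$,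 with $0\cdot\infty=0$. -/

import Mathlib

open Set Filter Topology MeasureTheory
open scoped ENNReal

namespace FrontTracking

/-! ### Piecewise constant front-tracking approximations of `∂ₜ u + ∂ₓ f(u) = 0`

Functions of space and time are written `u : ℝ → ℝ → ℝ`, with `u x t` the value at position `x` and
time `t`; only times `t ≥ 0` matter. -/

/-- The Oleinik entropy inequalities for a jump from the left state `l` to the right state `r`:
`(f w - f l) / (w - l) ≥ (f r - f l) / (r - l)` for every `w` strictly between `l` and `r`. -/
def Oleinik (f : ℝ → ℝ) (l r : ℝ) : Prop :=
  ∀ w, (l < w ∧ w < r ∨ r < w ∧ w < l) → (f r - f l) / (r - l) ≤ (f w - f l) / (w - l)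

/-- On the time interval `I`, which starts at time `τ`, the function `u` is piecewise constant with
exactly `n` fronts (jump lines). The `j`-th front is the straight line `x = y j + σ j * (t - τ)`, and
it separates the constant state `c j` on its left from the constant state `c (j + 1)` on its
right. The fronts do not meet in the interior of `I`; several of them may start from the same point
at time `τ`, and they may meet at the end of `I`. -/
structure IsFrontStrip (f : ℝ → ℝ) (h : ℝ) (u : ℝ → ℝ → ℝ) (τ : ℝ) (I : Set ℝ) {n : ℕ}
    (y σ : Fin n → ℝ) (c : Fin (n + 1) → ℝ) : Prop where
  /-- inside the time interval the fronts are distinct and numbered from left to right -/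
  ordered : ∀ t ∈ interior I, StrictMono fun j => y j + σ j * (t - τ)
  /-- `u` takes the value `c i` between the front number `i - 1` (included, so that `u` is
  right-continuous in space) and the front number `i` (excluded) -/
  value : ∀ t ∈ I, ∀ x, ∀ i : Fin (n + 1),
    (∀ j : Fin n, j.castSucc < i → y j + σ j * (t - τ) ≤ x) →
    (∀ j : Fin n, i ≤ j.castSucc → x < y j + σ j * (t - τ)) → u x t = c i
  /-- the fronts are jumps -/
  jump : ∀ j : Fin n, c j.castSucc ≠ c j.succ
  /-- the Rankine-Hugoniot relation for the flux `f` -/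
  rankineHugoniot : ∀ j : Fin n,
    σ j * (c j.succ - c j.castSucc) = f (c j.succ) - f (c j.castSucc)
  /-- every front is either a Lax shock, satisfying the Oleinik entropy inequalities, or a
  rarefaction jump, whose strength is at most `h` -/
  shock_or_small : ∀ j : Fin n,
    Oleinik f (c j.castSucc) (c j.succ) ∨ |c j.succ - c j.castSucc| ≤ h
  /-- the fronts issuing from one point at time `τ` solve the Riemann problem at that point by a
  monotone fan: their jumps all have the same sign -/
  fan : ∀ i j : Fin n, y i = y j → 0 < (c i.succ - c i.castSucc) * (c j.succ - c j.castSucc)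

/-- `u` is a front-tracking approximate solution of `∂ₜ u + ∂ₓ f(u) = 0` with parameter `h`, for
`t ≥ 0`. There are finitely many times `0 = T 0 < T 1 < ⋯ < T N` (these include all times at which
fronts interact). On each `[T k, T (k + 1)]` with `k < N` and on `[T N, ∞)`, `u` consists of
finitely many fronts that are straight lines, satisfy the Rankine-Hugoniot relation, and are either
Lax shocks or rarefaction jumps of strength at most `h`. At time `T 0 = 0` and at each interaction
the Riemann problem is solved by a monotone fan of such fronts. The value `u x (T (k + 1))` is
prescribed by both adjacent intervals, so that `u` is continuous in time with values in
`L¹` locally. -/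
def IsFrontTracking (f : ℝ → ℝ) (h : ℝ) (u : ℝ → ℝ → ℝ) : Prop :=
  ∃ (N : ℕ) (T : ℕ → ℝ), T 0 = 0 ∧ (∀ k < N, T k < T (k + 1)) ∧
    (∀ k < N, ∃ (n : ℕ) (y σ : Fin n → ℝ) (c : Fin (n + 1) → ℝ),
      IsFrontStrip f h u (T k) (Icc (T k) (T (k + 1))) y σ c) ∧
    ∃ (n : ℕ) (y σ : Fin n → ℝ) (c : Fin (n + 1) → ℝ),
      IsFrontStrip f h u (T N) (Ici (T N)) y σ c

/-! ### Jump points and Lax discontinuities of a piecewise constant coefficient -/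

/-- `(x, t)` is a jump point of `a`, lying on a discontinuity line of speed `σ`: near `(x, t)` the
function `a` takes one constant value on the left of the line, and another one on the right. -/
def IsJumpWithSpeed (a : ℝ → ℝ → ℝ) (x t σ : ℝ) : Prop :=
  ∃ l r : ℝ, l ≠ r ∧ ∀ᶠ p : ℝ × ℝ in 𝓝 (x, t),
    (p.1 < x + σ * (p.2 - t) → a p.1 p.2 = l) ∧ (x + σ * (p.2 - t) < p.1 → a p.1 p.2 = r)

open Classical in
/-- The speed of the discontinuity of `a` at the jump point `(x, t)`
(and `0` if `(x, t)` is not a jump point). -/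
noncomputable def jumpSpeed (a : ℝ → ℝ → ℝ) (x t : ℝ) : ℝ :=
  if H : ∃ σ, IsJumpWithSpeed a x t σ then H.choose else 0

/-- The left-hand trace `g (x-, t)`. -/
noncomputable def leftTrace (g : ℝ → ℝ → ℝ) (x t : ℝ) : ℝ :=
  Function.leftLim (fun y => g y t) x

/-- The right-hand trace `g (x+, t)`. -/
noncomputable def rightTrace (g : ℝ → ℝ → ℝ) (x t : ℝ) : ℝ :=
  Function.rightLim (fun y => g y t) x

/-- The set of Lax discontinuities of `a`: the jump points `(x, t)`, `t > 0`, at which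
`a (x-, t) > σ > a (x+, t)`, where `σ` is the speed of the discontinuity. -/
def laxSet (a : ℝ → ℝ → ℝ) : Set (ℝ × ℝ) :=
  {p | 0 < p.2 ∧ (∃ σ, IsJumpWithSpeed a p.1 p.2 σ) ∧
    rightTrace a p.1 p.2 < jumpSpeed a p.1 p.2 ∧ jumpSpeed a p.1 p.2 < leftTrace a p.1 p.2}

/-- The averaging coefficient `(f(v) - f(u)) / (v - u)`, which is `f'(u)` where `v = u`. -/
noncomputable def avgSpeed (f : ℝ → ℝ) (u v : ℝ → ℝ → ℝ) (x t : ℝ) : ℝ :=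
  dslope f (u x t) (v x t)

/-- The `L¹` distance on the real line of `u` and `v` at time `t` (possibly `∞`). -/
noncomputable def l1Dist (u v : ℝ → ℝ → ℝ) (t : ℝ) : ℝ≥0∞ :=
  eLpNorm (fun x => v x t - u x t) 1 volume

/-- The total variation of `u` at time `t` on the real line. -/
noncomputable def totalVariation (u : ℝ → ℝ → ℝ) (t : ℝ) : ℝ≥0∞ :=
  eVariationOn (fun x => u x t) univ

/-- The rate at time `τ` at which the Lax discontinuities of `a` dissipate the `L¹` distance: the
sum over all Lax discontinuities `(x, τ)` of
`2 (a(x-, τ) - σ(x, τ)) |v(x-, τ) - u(x-, τ)|`; its terms are nonnegative. -/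
noncomputable def laxDissipation (a u v : ℝ → ℝ → ℝ) (τ : ℝ) : ℝ≥0∞ :=
  ∑' x : {x : ℝ // (x, τ) ∈ laxSet a},
    ENNReal.ofReal (2 * (leftTrace a x τ - jumpSpeed a x τ) * |leftTrace v x τ - leftTrace u x τ|)

/-- The speed of a discontinuity is uniquely determined. -/
theorem IsJumpWithSpeed.unique {a : ℝ → ℝ → ℝ} {x t σ₁ σ₂ : ℝ}
    (h₁ : IsJumpWithSpeed a x t σ₁) (h₂ : IsJumpWithSpeed a x t σ₂) : σ₁ = σ₂ := by
  by_contra hne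
  wlog hlt : σ₁ < σ₂ generalizing σ₁ σ₂
  · exact this h₂ h₁ (Ne.symm hne) (lt_of_le_of_ne (not_lt.mp hlt) (Ne.symm hne))
  obtain ⟨l₁, r₁, hlr₁, e₁⟩ := h₁
  obtain ⟨l₂, r₂, -, e₂⟩ := h₂
  have path : ∀ m : ℝ, Tendsto (fun s : ℝ => (x + m * s, t + s)) (𝓝 0) (𝓝 (x, t)) := by
    intro m
    have : Continuous fun s : ℝ => (x + m * s, t + s) := by fun_prop
    simpa using this.tendsto 0
  have ev := e₁.and e₂
  have hm := (path ((σ₁ + σ₂) / 2)).eventually ev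
  have hl := (path (σ₁ - 1)).eventually ev
  obtain ⟨ε, hε, H⟩ := Metric.eventually_nhds_iff.mp (hm.and hl)
  have d : dist (ε / 2) 0 < ε := by
    rw [Real.dist_eq, sub_zero, abs_of_pos (by positivity)]; linarith
  obtain ⟨⟨a1, a2⟩, b1, b2⟩ := H d
  have p1 := a1.2 (by dsimp only; nlinarith)
  have p2 := a2.1 (by dsimp only; nlinarith)
  have q1 := b1.1 (by dsimp only; nlinarith)
  have q2 := b2.1 (by dsimp only; nlinarith)
  exact hlr₁ (q1.symm.trans (q2.trans (p2.symm.trans p1)))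

end FrontTracking

/-!
Put `G = v - u` for two front-tracking approximations `u` and `v`, and let `a` be their averaging
coefficient. Between interactions of fronts the `L¹` norm of `G` is affine in time, and its slope
is a sum over the fronts of both. Since `a * |G|` vanishes at `±∞`, the contribution of a front of
speed `σ` may be taken to be the jump of `(a - σ) * |G|`. By the Rankine-Hugoniot relation
`(a - σ) * G` does not jump, so that only the fronts at which `G` changes sign contribute: there
`a - σ` changes sign as well. If it decreases, the front is a Lax discontinuity of `a` and accounts
for the dissipation term. If it increases, the Oleinik inequalities bound the contribution by the
error of the chord of `f` across a rarefaction front, which is quadratic in the strength of the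
front, hence at most `h` times its variation. Finally, the total variation does not increase in
time, because fans are monotone.
-/

namespace FrontTracking

open scoped NNReal

/-! ### Step functions -/

section StepFunction

variable {X E : Type*} [LinearOrder X] {n : ℕ} {w : Fin n → X}

/-- The index of the cell containing `x`, among the `n + 1` cells cut out by the positions `w j`.
A position belongs to the cell on its right. -/
def cellIndex (w : Fin n → X) (x : X) : Fin (n + 1) :=
  ⟨Finset.card {j | w j ≤ x}, Nat.lt_succ_of_le (card_finset_fin_le _)⟩

theorem cellIndex_mono (w : Fin n → X) : Monotone (cellIndex w) := fun _ _ hxy =>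
  Fin.mk_le_mk.mpr (Finset.card_le_card fun _ hj => by
    simp only [Finset.mem_filter_univ] at hj ⊢
    exact hj.trans hxy)

theorem castSucc_lt_cellIndex_iff (hw : Monotone w) {j : Fin n} {x : X} :
    j.castSucc < cellIndex w x ↔ w j ≤ x := by
  change (j : ℕ) < Finset.card {i | w i ≤ x} ↔ w j ≤ x
  refine ⟨fun hj => ?_, fun hj => ?_⟩
  · by_contra hx
    have hsub : ({i | w i ≤ x} : Finset (Fin n)) ⊆ Finset.Iio j := fun i hi =>
      Finset.mem_Iio.mpr (hw.reflect_lt ((Finset.mem_filter.mp hi).2.trans_lt (not_le.mp hx)))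
    exact hj.not_ge (by simpa using Finset.card_le_card hsub)
  · have hsub : Finset.Iic j ⊆ ({i | w i ≤ x} : Finset (Fin n)) := fun i hi =>
      Finset.mem_filter.mpr ⟨Finset.mem_univ i, (hw (Finset.mem_Iic.mp hi)).trans hj⟩
    exact Nat.lt_of_succ_le (by simpa using Finset.card_le_card hsub)

/-- `g` is a right-continuous step function: it takes the values `c 0, c 1, …` on the cells between
the successive positions `w 0, w 1, …`. Positions may coincide. -/
def IsStep (g : X → E) (w : Fin n → X) (c : Fin (n + 1) → E) : Prop :=
  ∀ x, ∀ i : Fin (n + 1), (∀ j : Fin n, j.castSucc < i → w j ≤ x) →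
    (∀ j : Fin n, i ≤ j.castSucc → x < w j) → g x = c i

theorem isStep_cellIndex (w : Fin n → X) : IsStep (cellIndex w) w id := fun x i hl hr => by
  have hiff : ∀ j, w j ≤ x ↔ j.castSucc < i := fun j =>
    ⟨fun hj => not_le.mp fun hi => (hr j hi).not_ge hj, hl j⟩
  refine Fin.ext ?_
  simp only [cellIndex, hiff, Fin.lt_def, Fin.val_castSucc, Fin.card_filter_val_lt, id]
  exact min_eq_right i.is_le

variable {g : X → E} {c : Fin (n + 1) → E}

theorem IsStep.comp₂ {E' F : Type*} {g' : X → E'} {c' : Fin (n + 1) → E'} (hg : IsStep g w c)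
    (hg' : IsStep g' w c') (φ : E → E' → F) :
    IsStep (fun x => φ (g x) (g' x)) w fun i => φ (c i) (c' i) := fun x i hl hr =>
  congrArg₂ φ (hg x i hl hr) (hg' x i hl hr)

theorem IsStep.eq_cellIndex (hg : IsStep g w c) (hw : Monotone w) (x : X) :
    g x = c (cellIndex w x) :=
  hg x _ (fun _ hj => (castSucc_lt_cellIndex_iff hw).mp hj) fun _ hj =>
    not_le.mp fun hx => hj.not_gt ((castSucc_lt_cellIndex_iff hw).mpr hx)

theorem IsStep.eq_first (hg : IsStep g w c) {x : X} (hx : ∀ j, x < w j) : g x = c 0 :=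
  hg x 0 (fun _ hj => absurd hj (Fin.not_lt_zero _)) fun j _ => hx j

theorem IsStep.eq_last (hg : IsStep g w c) {x : X} (hx : ∀ j, w j ≤ x) : g x = c (Fin.last n) :=
  hg x (Fin.last n) (fun j _ => hx j)
    fun j hj => absurd hj (Fin.castSucc_lt_last j).not_ge

theorem exists_forall_lt [NoMinOrder X] [Nonempty X] (w : Fin n → X) : ∃ x, ∀ j, x < w j := by
  obtain ⟨m, hm⟩ := (finite_range w).bddBelow
  obtain ⟨x, hx⟩ := exists_lt m
  exact ⟨x, fun j => hx.trans_le (hm (mem_range_self j))⟩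

theorem IsStep.range_subset_range [NoMinOrder X] [Nonempty X] (hg : IsStep g w c)
    (hw : StrictMono w) : range c ⊆ range g := by
  rintro _ ⟨i, rfl⟩
  rcases Fin.eq_zero_or_eq_succ i with rfl | ⟨j, rfl⟩
  · obtain ⟨x, hx⟩ := exists_forall_lt w
    exact ⟨x, hg.eq_first hx⟩
  · exact ⟨w j, hg _ _ (fun i hi => hw.monotone (Fin.castSucc_lt_succ_iff.mp hi))
      fun i hi => hw (Fin.succ_le_castSucc_iff.mp hi)⟩

theorem sum_ite_castSucc_lt [AddCommGroup E] (c : Fin (n + 1) → E) (e : Fin (n + 1)) :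
    ∑ j : Fin n, (if j.castSucc < e then c j.succ - c j.castSucc else 0) = c e - c 0 := by
  induction e using Fin.induction with
  | zero => simp
  | succ i ih =>
    have hinsert : Finset.univ.filter (fun j : Fin n => j.castSucc < i.succ)
        = insert i (Finset.univ.filter fun j : Fin n => j.castSucc < i.castSucc) := by
      ext j
      simp [Fin.castSucc_lt_succ_iff, le_iff_eq_or_lt]
    rw [← Finset.sum_filter] at ih ⊢
    rw [hinsert, Finset.sum_insert (by simp), ih, sub_add_sub_cancel]

theorem sum_succ_sub_castSucc [AddCommGroup E] (c : Fin (n + 1) → E) :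
    ∑ j : Fin n, (c j.succ - c j.castSucc) = c (Fin.last n) - c 0 := by
  simpa only [Fin.castSucc_lt_last, if_true] using sum_ite_castSucc_lt c (Fin.last n)

theorem IsStep.eq_add_sum [AddCommGroup E] (hg : IsStep g w c) (hw : Monotone w) (x : X) :
    g x = c 0 + ∑ j : Fin n, if w j ≤ x then c j.succ - c j.castSucc else 0 := by
  simp only [hg.eq_cellIndex hw, ← castSucc_lt_cellIndex_iff hw, sum_ite_castSucc_lt,
    add_sub_cancel]

end StepFunction

/-! ### Total variation of step functions -/

section Variation

variable {X : Type*} [LinearOrder X] {n : ℕ} {w : Fin n → X}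

theorem eVariationOn_fin {E : Type*} [PseudoEMetricSpace E] (c : Fin (n + 1) → E) :
    eVariationOn c univ = ∑ j : Fin n, edist (c j.castSucc) (c j.succ) := by
  let ι : ℕ → Fin (n + 1) := fun k => ⟨min k n, by omega⟩
  have hmono : Monotone ι := fun a b hab => min_le_min_right n hab
  have himage : ι '' Iic n = univ :=
    eq_univ_of_forall fun i => ⟨i, Fin.is_le i, Fin.ext (min_eq_left (Fin.is_le i))⟩
  rw [← himage, eVariationOn.image_range_of_monotone c hmono,
    ← Fin.sum_univ_eq_sum_range fun k => edist (c (ι k)) (c (ι (k + 1)))]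
  refine Finset.sum_congr rfl fun j _ => ?_
  congr 2 <;> exact Fin.ext (min_eq_left (by omega))

theorem eVariationOn_fin_real (c : Fin (n + 1) → ℝ) :
    eVariationOn c univ = ENNReal.ofReal (∑ j : Fin n, |c j.succ - c j.castSucc|) := by
  rw [eVariationOn_fin, ENNReal.ofReal_sum_of_nonneg fun _ _ => abs_nonneg _]
  exact Finset.sum_congr rfl fun j _ => by rw [edist_comm, edist_dist, Real.dist_eq]

theorem IsStep.eVariationOn_le {E : Type*} [PseudoEMetricSpace E] {g : X → E}
    {c : Fin (n + 1) → E} (hg : IsStep g w c) (hw : Monotone w) :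
    eVariationOn g univ ≤ eVariationOn c univ := by
  rw [funext (hg.eq_cellIndex hw)]
  exact eVariationOn.comp_le_of_monotoneOn c _ ((cellIndex_mono w).monotoneOn _) (mapsTo_univ _ _)

theorem exists_strictMono_factor {ι : Type*} [Finite ι] (w : ι → X) :
    ∃ (k : ℕ) (φ : Fin k → X) (ρ : ι → Fin k),
      StrictMono φ ∧ Function.Surjective ρ ∧ ∀ i, φ (ρ i) = w i := by
  have hfin := finite_range w
  have := hfin.fintype
  let φ := hfin.toFinset.orderEmbOfFin rfl
  have hrange : range φ = range w := by
    simpa only [Finite.coe_toFinset] using hfin.toFinset.range_orderEmbOfFin rfl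
  choose ρ hρ using fun i => hrange.ge (mem_range_self i)
  refine ⟨_, φ, ρ, φ.strictMono, fun k => ?_, hρ⟩
  obtain ⟨i, hi⟩ := hrange.le (mem_range_self k)
  exact ⟨i, φ.injective ((hρ i).trans hi)⟩

theorem IsStep.sub_eq_sum_filter {E : Type*} [AddCommGroup E] {g : X → E} {c : Fin (n + 1) → E}
    (hg : IsStep g w c) (hw : Monotone w) {a b : X} (hab : a < b)
    (hgap : ∀ j, a < w j → b ≤ w j) :
    g b - g a = ∑ j with w j = b, (c j.succ - c j.castSucc) := by
  rw [hg.eq_add_sum hw a, hg.eq_add_sum hw b, add_sub_add_left_eq_sub, ← Finset.sum_sub_distrib,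
    Finset.sum_filter]
  refine Finset.sum_congr rfl fun j _ => ?_
  rcases le_or_gt (w j) a with ha | ha
  · simp [ha, ha.trans hab.le, (ha.trans_lt hab).ne]
  · simp [ha.not_ge, (hgap j ha).ge_iff_eq']

theorem abs_sum_of_mul_pos {ι : Type*} {s : Finset ι} {d : ι → ℝ}
    (hd : ∀ i ∈ s, ∀ j ∈ s, 0 < d i * d j) : |∑ i ∈ s, d i| = ∑ i ∈ s, |d i| := by
  rcases s.eq_empty_or_nonempty with rfl | ⟨i₀, hi₀⟩
  · simp
  rcases lt_or_ge 0 (d i₀) with hpos | hneg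
  · have hnonneg : ∀ i ∈ s, 0 ≤ d i := fun i hi =>
      (pos_of_mul_pos_right (hd i₀ hi₀ i hi) hpos.le).le
    rw [Finset.abs_sum_of_nonneg hnonneg]
    exact Finset.sum_congr rfl fun i hi => (abs_of_nonneg (hnonneg i hi)).symm
  · have hnonpos : ∀ i ∈ s, d i ≤ 0 := fun i hi =>
      (neg_of_mul_pos_right (hd i₀ hi₀ i hi) hneg).le
    rw [abs_of_nonpos (Finset.sum_nonpos hnonpos), ← Finset.sum_neg_distrib]
    exact Finset.sum_congr rfl fun i hi => (abs_of_nonpos (hnonpos i hi)).symm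

/-- At coinciding positions only the sum of the jumps is visible in `g`; if these jumps have the
same sign, they do not cancel. -/
theorem IsStep.le_eVariationOn [NoMinOrder X] [Nonempty X] {g : X → ℝ} {c : Fin (n + 1) → ℝ}
    (hg : IsStep g w c) (hw : Monotone w)
    (hfan : ∀ i j, w i = w j → 0 < (c i.succ - c i.castSucc) * (c j.succ - c j.castSucc)) :
    eVariationOn c univ ≤ eVariationOn g univ := by
  obtain ⟨k, φ, ρ, hφ, -, hρ⟩ := exists_strictMono_factor w
  obtain ⟨x₀, hx₀⟩ := exists_forall_lt φ
  set x : Fin (k + 1) → X := Fin.cons x₀ φ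
  have hx : StrictMono x := Fin.strictMono_cons.mpr ⟨hx₀, hφ⟩
  have hjump : ∀ i : Fin k, g (x i.succ) - g (x i.castSucc)
      = ∑ j with ρ j = i, (c j.succ - c j.castSucc) := fun i => by
    rw [hg.sub_eq_sum_filter hw (hx i.castSucc_lt_succ) fun j hj => ?_]
    · simp only [x, Fin.cons_succ, ← hρ, hφ.injective.eq_iff]
    · rw [← hρ] at hj ⊢
      have hlt : i.castSucc < (ρ j).succ := hx.lt_iff_lt.mp hj
      exact hx.monotone (Fin.castSucc_lt_iff_succ_le.mp hlt)
  calc eVariationOn c univ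
      = ENNReal.ofReal (∑ i, ∑ j with ρ j = i, |c j.succ - c j.castSucc|) := by
        rw [eVariationOn_fin_real, Finset.sum_fiberwise]
    _ = ENNReal.ofReal (∑ i : Fin k, |g (x i.succ) - g (x i.castSucc)|) := by
        congr 1
        refine Finset.sum_congr rfl fun i _ => ?_
        rw [hjump, abs_sum_of_mul_pos fun a ha b hb => hfan a b ?_]
        rw [← hρ, ← hρ, (Finset.mem_filter.mp ha).2, (Finset.mem_filter.mp hb).2]
    _ = eVariationOn (g ∘ x) univ := (eVariationOn_fin_real (g ∘ x)).symm
    _ ≤ eVariationOn g univ :=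
        eVariationOn.comp_le_of_monotoneOn g x (hx.monotone.monotoneOn _) (mapsTo_univ _ _)

end Variation

/-! ### Integrals of step functions -/

section Integral

variable {E : Type*} [NormedAddCommGroup E] {n : ℕ} {w : Fin n → ℝ} {g : ℝ → E}
  {c : Fin (n + 1) → E}

theorem eq_zero_of_measure_eq_top {X : Type*} [MeasurableSpace X] {μ : Measure X} {g : X → E}
    {S : Set X} {a : E} (hSm : MeasurableSet S) (hS : μ S = ∞) (hg : EqOn g (fun _ => a) S)
    (hfin : ∫⁻ x, ‖g x‖ₑ ∂μ ≠ ∞) : a = 0 := by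
  by_contra ha
  refine hfin (top_le_iff.mp ?_)
  calc ∞ = ∫⁻ _ in S, ‖a‖ₑ ∂μ := by
        rw [setLIntegral_const, hS, ENNReal.mul_top (enorm_ne_zero.mpr ha)]
    _ = ∫⁻ x in S, ‖g x‖ₑ ∂μ :=
        setLIntegral_congr_fun hSm fun x hx => congrArg enorm (hg hx).symm
    _ ≤ ∫⁻ x, ‖g x‖ₑ ∂μ := setLIntegral_le_lintegral S _

theorem IsStep.eq_zero_of_lintegral_enorm_ne_top (hg : IsStep g w c)
    (hfin : ∫⁻ x, ‖g x‖ₑ ≠ ∞) : c 0 = 0 ∧ c (Fin.last n) = 0 := by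
  obtain ⟨m, hm⟩ := exists_forall_lt w
  obtain ⟨M, hM⟩ := (finite_range w).bddAbove
  constructor
  · exact eq_zero_of_measure_eq_top measurableSet_Iic (Real.volume_Iic (a := m))
      (fun x hx => hg.eq_first fun j => lt_of_le_of_lt hx (hm j)) hfin
  · exact eq_zero_of_measure_eq_top measurableSet_Ici (Real.volume_Ici (a := M))
      (fun x hx => hg.eq_last fun j => (hM (mem_range_self j)).trans hx) hfin

theorem IsStep.eq_sum_indicator (hg : IsStep g w c) (hw : Monotone w) (hfirst : c 0 = 0)
    (hlast : c (Fin.last n) = 0) {R : ℝ} (hR : ∀ j, w j ≤ R) :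
    g = fun x => ∑ j : Fin n, (Ico (w j) R).indicator (fun _ => c j.succ - c j.castSucc) x := by
  funext x
  rcases lt_or_ge x R with hx | hx
  · simp only [hg.eq_add_sum hw x, hfirst, zero_add, indicator, mem_Ico, hx, and_true]
  · simp only [hg.eq_last fun j => (hR j).trans hx, hlast, indicator, mem_Ico, hx.not_gt, and_false,
      if_false, Finset.sum_const_zero]

theorem integrable_indicator_Ico (a b : ℝ) (e : E) :
    Integrable ((Ico a b).indicator fun _ => e) :=
  (integrable_indicator_iff measurableSet_Ico).mpr (integrableOn_const measure_Ico_lt_top.ne)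

theorem IsStep.integrable (hg : IsStep g w c) (hw : Monotone w) (hfirst : c 0 = 0)
    (hlast : c (Fin.last n) = 0) : Integrable g := by
  obtain ⟨R, hR⟩ := (finite_range w).bddAbove
  rw [hg.eq_sum_indicator hw hfirst hlast fun j => hR (mem_range_self j)]
  exact integrable_finsetSum _ fun j _ => integrable_indicator_Ico _ _ _

theorem IsStep.integral_eq [NormedSpace ℝ E] [CompleteSpace E] (hg : IsStep g w c)
    (hw : Monotone w) (hfirst : c 0 = 0) (hlast : c (Fin.last n) = 0) :
    ∫ x, g x = ∑ j : Fin n, w j • (c j.castSucc - c j.succ) := by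
  obtain ⟨R, hR⟩ := (finite_range w).bddAbove
  replace hR : ∀ j, w j ≤ R := fun j => hR (mem_range_self j)
  calc ∫ x, g x = ∑ j : Fin n, (R - w j) • (c j.succ - c j.castSucc) := by
        rw [hg.eq_sum_indicator hw hfirst hlast hR,
          integral_finsetSum _ fun j _ => integrable_indicator_Ico _ _ _]
        refine Finset.sum_congr rfl fun j _ => ?_
        rw [integral_indicator_const _ measurableSet_Ico, Real.volume_real_Ico_of_le (hR j)]
    _ = R • ∑ j : Fin n, (c j.succ - c j.castSucc)
          + ∑ j : Fin n, w j • (c j.castSucc - c j.succ) := by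
        rw [Finset.smul_sum, ← Finset.sum_add_distrib]
        exact Finset.sum_congr rfl fun j _ => by module
    _ = ∑ j : Fin n, w j • (c j.castSucc - c j.succ) := by
        rw [sum_succ_sub_castSucc, hfirst, hlast, sub_self, smul_zero, zero_add]

end Integral

/-! ### The balance of the `L¹` distance across one front -/

section FrontBalance

/-- The flux across a line of speed `σ` of the conserved quantity of `∂ₜ u + ∂ₓ f(u) = 0`, where
`u = w`. The Rankine–Hugoniot relation says that it takes the same value on the two sides of a
front. -/
def relFlux (f : ℝ → ℝ) (σ w : ℝ) : ℝ := f w - σ * w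

/-- The conditions on a front of speed `σ` in a front-tracking approximation with parameter `h`,
with left and right states `l` and `r`. The case `l = r` of a front without a jump is admitted, so
that further fronts may be inserted into a piecewise constant function. -/
structure IsAdmissibleFront (f : ℝ → ℝ) (h σ l r : ℝ) : Prop where
  relFlux_eq : relFlux f σ r = relFlux f σ l
  shock_or_small : Oleinik f l r ∨ |r - l| ≤ h

theorem IsAdmissibleFront.refl (f : ℝ → ℝ) (h σ l : ℝ) : IsAdmissibleFront f h σ l l :=
  ⟨rfl, Or.inl fun _ hw => (lt_irrefl l (hw.elim (fun hw => hw.1.trans hw.2)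
    fun hw => hw.1.trans hw.2)).elim⟩

variable {f : ℝ → ℝ} {h σ : ℝ}

theorem exists_relFlux_sub_eq (hf : Differentiable ℝ f) (σ a b : ℝ) :
    ∃ z ∈ segment ℝ a b, relFlux f σ b - relFlux f σ a = (deriv f z - σ) * (b - a) := by
  have hderiv : ∀ x ∈ segment ℝ a b,
      HasFDerivWithinAt (relFlux f σ) (ContinuousLinearMap.toSpanSingleton ℝ (deriv f x - σ))
        (segment ℝ a b) x := fun x _ => by
    have hx := (hf x).hasDerivAt.sub ((hasDerivAt_id x).const_mul σ)
    rw [mul_one] at hx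
    exact hx.hasFDerivAt.hasFDerivWithinAt
  obtain ⟨z, hz, heq⟩ := domain_mvt hderiv (convex_segment a b) (left_mem_segment ℝ a b)
    (right_mem_segment ℝ a b)
  refine ⟨z, hz, heq.trans ?_⟩
  simp [mul_comm]

variable {L : ℝ≥0} {D : Set ℝ} {l r w : ℝ}

/-- By Rankine–Hugoniot, `relFlux f σ` has a critical point between `l` and `r`. -/
theorem abs_relFlux_sub_le_sq (hf : Differentiable ℝ f) (hL : LipschitzOnWith L (deriv f) D)
    (hD : Convex ℝ D) (hl : l ∈ D) (hr : r ∈ D) (heq : relFlux f σ r = relFlux f σ l)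
    (hw : w ∈ segment ℝ l r) : |relFlux f σ w - relFlux f σ l| ≤ L * |r - l| * |r - l| := by
  rcases eq_or_ne l r with rfl | hne
  · rw [segment_same, mem_singleton_iff] at hw
    simp [hw]
  obtain ⟨z₀, hz₀, hcrit⟩ := exists_relFlux_sub_eq hf σ l r
  rw [heq, sub_self, zero_eq_mul, or_iff_left (sub_ne_zero.mpr hne.symm), sub_eq_zero] at hcrit
  obtain ⟨z, hz, hval⟩ := exists_relFlux_sub_eq hf σ l w
  replace hz : z ∈ segment ℝ l r :=
    (convex_segment l r).segment_subset (left_mem_segment ℝ l r) hw hz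
  have hdist : ∀ x ∈ segment ℝ l r, ∀ y ∈ segment ℝ l r, |x - y| ≤ |r - l| := fun x hx y hy => by
    rw [segment_eq_uIcc] at hx hy
    exact abs_sub_le_of_uIcc_subset_uIcc (uIcc_subset_uIcc hy hx)
  have hmem := hD.segment_subset hl hr
  calc |relFlux f σ w - relFlux f σ l| = |deriv f z - deriv f z₀| * |w - l| := by
        rw [hval, ← hcrit, abs_mul]
    _ ≤ L * |z - z₀| * |w - l| := by
        gcongr
        simpa only [Real.dist_eq] using hL.dist_le_mul z (hmem hz) z₀ (hmem hz₀)
    _ ≤ L * |r - l| * |r - l| := by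
        have hzz := hdist z hz z₀ hz₀
        have hwl := hdist w hw l (left_mem_segment ℝ l r)
        gcongr

theorem Oleinik.mul_relFlux_sub_nonneg (hO : Oleinik f l r) (heq : relFlux f σ r = relFlux f σ l)
    (hw : l < w ∧ w < r ∨ r < w ∧ w < l) :
    0 ≤ (r - l) * (relFlux f σ w - relFlux f σ l) := by
  unfold relFlux at heq ⊢
  have hO := hO w hw
  rcases hw with ⟨hlw, hwr⟩ | ⟨hrw, hwl⟩
  · have hs : (f r - f l) / (r - l) = σ := by
      rw [div_eq_iff (by linarith)]; linarith
    rw [hs, le_div_iff₀ (by linarith)] at hO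
    exact mul_nonneg (by linarith) (by linarith)
  · have hs : (f r - f l) / (r - l) = σ := by
      rw [div_eq_iff (by linarith)]; linarith
    rw [hs, le_div_iff_of_neg (by linarith)] at hO
    exact mul_nonneg_of_nonpos_of_nonpos (by linarith) (by linarith)

/-- Shocks do not violate the entropy inequality at all, and rarefaction fronts only a little. -/
theorem IsAdmissibleFront.abs_relFlux_sub_le (hF : IsAdmissibleFront f h σ l r)
    (hf : Differentiable ℝ f) (hL : LipschitzOnWith L (deriv f) D)
    (hD : Convex ℝ D) (hl : l ∈ D) (hr : r ∈ D) (hw : l < w ∧ w < r ∨ r < w ∧ w < l)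
    (hviol : (r - l) * (relFlux f σ w - relFlux f σ l) < 0) :
    |relFlux f σ w - relFlux f σ l| ≤ h * L * |r - l| := by
  have hsmall : |r - l| ≤ h := hF.shock_or_small.resolve_left fun hO =>
    hviol.not_ge (hO.mul_relFlux_sub_nonneg hF.relFlux_eq hw)
  have hseg : w ∈ segment ℝ l r := by
    rw [segment_eq_uIcc, mem_uIcc]
    exact hw.imp (fun hw => ⟨hw.1.le, hw.2.le⟩) fun hw => ⟨hw.1.le, hw.2.le⟩
  calc |relFlux f σ w - relFlux f σ l| ≤ L * |r - l| * |r - l| :=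
        abs_relFlux_sub_le_sq hf hL hD hl hr hF.relFlux_eq hseg
    _ ≤ L * h * |r - l| := by gcongr
    _ = h * L * |r - l| := by ring

variable {U U' V V' : ℝ}

/-- Since the two fronts cross in state space, one of the four states lies strictly between the two
states of the other function. -/
theorem abs_relFlux_sub_le_of_lt (hU : IsAdmissibleFront f h σ U U')
    (hV : IsAdmissibleFront f h σ V V') (hf : Differentiable ℝ f) (hh : 0 ≤ h)
    (hL : LipschitzOnWith L (deriv f) D) (hD : Convex ℝ D) (hUD : U ∈ D) (hUD' : U' ∈ D)
    (hVD : V ∈ D) (hVD' : V' ∈ D) (hUV : U < V) (hVU' : V' < U')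
    (hlt : relFlux f σ V < relFlux f σ U) :
    |relFlux f σ V - relFlux f σ U| ≤ h * L * (|U' - U| + |V' - V|) := by
  have hU₀ : 0 ≤ h * L * |U' - U| := by positivity
  have hV₀ : 0 ≤ h * L * |V' - V| := by positivity
  rw [mul_add]
  have inside_U : ∀ w, U < w → w < U' → relFlux f σ w = relFlux f σ V →
      |relFlux f σ V - relFlux f σ U| ≤ h * L * |U' - U| := fun w hUw hwU' hw => by
    rw [← hw] at hlt ⊢
    exact hU.abs_relFlux_sub_le hf hL hD hUD hUD' (Or.inl ⟨hUw, hwU'⟩)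
      (mul_neg_of_pos_of_neg (sub_pos.mpr (hUw.trans hwU')) (sub_neg.mpr hlt))
  rcases lt_or_ge V' U with hV'U | hUV'
  · have hle := hV.abs_relFlux_sub_le hf hL hD hVD hVD' (Or.inr ⟨hV'U, hUV⟩)
      (mul_neg_of_neg_of_pos (sub_neg.mpr (hV'U.trans hUV)) (sub_pos.mpr hlt))
    rw [abs_sub_comm] at hle
    linarith
  rcases hUV'.eq_or_lt with heq | hUV'
  · exact absurd (heq ▸ hV.relFlux_eq) hlt.ne'
  · linarith [inside_U V' hUV' hVU' hV.relFlux_eq]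

theorem abs_relFlux_sub_le_of_crossing (hU : IsAdmissibleFront f h σ U U')
    (hV : IsAdmissibleFront f h σ V V') (hf : Differentiable ℝ f) (hh : 0 ≤ h)
    (hL : LipschitzOnWith L (deriv f) D) (hD : Convex ℝ D) (hUD : U ∈ D) (hUD' : U' ∈ D)
    (hVD : V ∈ D) (hVD' : V' ∈ D) (hcross : (V - U) * (V' - U') < 0)
    (hviol : (V - U) * (relFlux f σ V - relFlux f σ U) < 0) :
    |relFlux f σ V - relFlux f σ U| ≤ h * L * (|U' - U| + |V' - V|) := by
  rcases lt_or_ge U V with hUV | hVU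
  · have hpos : 0 < V - U := sub_pos.mpr hUV
    exact abs_relFlux_sub_le_of_lt hU hV hf hh hL hD hUD hUD' hVD hVD' hUV
      (sub_neg.mp (neg_of_mul_neg_right hcross hpos.le))
      (sub_neg.mp (neg_of_mul_neg_right hviol hpos.le))
  · have hneg : V - U < 0 := by
      refine lt_of_le_of_ne (sub_nonpos.mpr hVU) fun h₀ => ?_
      simp [h₀] at hcross
    rw [abs_sub_comm, add_comm]
    exact abs_relFlux_sub_le_of_lt hV hU hf hh hL hD hVD hVD' hUD hUD' (sub_neg.mp hneg)
      (sub_pos.mp (pos_of_mul_neg_right hcross hneg.le))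
      (sub_pos.mp (pos_of_mul_neg_right hviol hneg.le))

/-- The rate at which a front of speed `σ` dissipates the `L¹` distance if it is a Lax discontinuity
of the averaging coefficient, with traces `a` and `a'`, where `G` is the difference of the left
states. -/
noncomputable def laxTerm (a a' σ G : ℝ) : ℝ :=
  if a' < σ ∧ σ < a then 2 * (a - σ) * |G| else 0

theorem laxTerm_nonneg (a a' σ G : ℝ) : 0 ≤ laxTerm a a' σ G := by
  unfold laxTerm
  split_ifs with hLax
  · have := sub_pos.mpr hLax.2
    positivity
  · exact le_rfl

section LaxTerm

variable {a a' G G' : ℝ}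

theorem laxTerm_le_of_not_lt_lt (heq : (a - σ) * G = (a' - σ) * G') (hnot : ¬(a < σ ∧ σ < a')) :
    laxTerm a a' σ G ≤ (a - σ) * |G| - (a' - σ) * |G'| := by
  have habs : |a - σ| * |G| = |a' - σ| * |G'| := by rw [← abs_mul, ← abs_mul, heq]
  have h₀ : 0 ≤ |a - σ| * |G| := by positivity
  unfold laxTerm
  rcases le_or_gt a' σ with ha' | ha' <;> rcases lt_or_ge a σ with ha | ha
  · rw [if_neg fun hLax => hLax.2.not_gt ha]
    rw [abs_of_neg (sub_neg.mpr ha), abs_of_nonpos (sub_nonpos.mpr ha')] at habs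
    linarith
  · rw [abs_of_nonneg (sub_nonneg.mpr ha)] at habs h₀
    rw [abs_of_nonpos (sub_nonpos.mpr ha')] at habs
    split_ifs <;> linarith
  · exact absurd ⟨ha, ha'⟩ hnot
  · rw [if_neg fun hLax => hLax.1.not_gt ha']
    rw [abs_of_nonneg (sub_nonneg.mpr ha), abs_of_pos (sub_pos.mpr ha')] at habs
    linarith

theorem laxTerm_eq_of_lt_of_lt (heq : (a - σ) * G = (a' - σ) * G') (ha : a < σ) (ha' : σ < a') :
    laxTerm a a' σ G = (a - σ) * |G| - (a' - σ) * |G'| + 2 * |(a - σ) * G| := by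
  have hleft : |(a - σ) * G| = -((a - σ) * |G|) := by
    rw [abs_mul, abs_of_neg (sub_neg.mpr ha), neg_mul]
  have hright : |(a - σ) * G| = (a' - σ) * |G'| := by
    rw [heq, abs_mul, abs_of_pos (sub_pos.mpr ha')]
  rw [laxTerm, if_neg fun hLax => hLax.2.not_gt ha]
  linarith

end LaxTerm

theorem dslope_sub_mul (f : ℝ → ℝ) (σ U V : ℝ) :
    (dslope f U V - σ) * (V - U) = relFlux f σ V - relFlux f σ U := by
  have hslope : (V - U) * dslope f U V = f V - f U := sub_smul_dslope f U V
  unfold relFlux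
  linear_combination hslope

theorem front_balance (hU : IsAdmissibleFront f h σ U U') (hV : IsAdmissibleFront f h σ V V')
    (hf : Differentiable ℝ f) (hh : 0 ≤ h) (hL : LipschitzOnWith L (deriv f) D)
    (hD : Convex ℝ D) (hUD : U ∈ D) (hUD' : U' ∈ D) (hVD : V ∈ D) (hVD' : V' ∈ D) :
    σ * (|V - U| - |V' - U'|) + laxTerm (dslope f U V) (dslope f U' V') σ (V - U)
      ≤ dslope f U V * |V - U| - dslope f U' V' * |V' - U'|
        + 2 * h * L * (|U' - U| + |V' - V|) := by
  have hQ := dslope_sub_mul f σ U V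
  have hQ' := dslope_sub_mul f σ U' V'
  rw [hU.relFlux_eq, hV.relFlux_eq, ← hQ] at hQ'
  set a := dslope f U V
  set a' := dslope f U' V'
  have herr : 0 ≤ h * L * (|U' - U| + |V' - V|) := by positivity
  by_cases hraref : a < σ ∧ σ < a'
  · have hflux : |(a - σ) * (V - U)| ≤ h * L * (|U' - U| + |V' - V|) := by
      rcases eq_or_ne U V with rfl | hne
      · simpa using herr
      have hviol : (V - U) * ((a - σ) * (V - U)) < 0 := by
        have := mul_neg_of_neg_of_pos (sub_neg.mpr hraref.1) (sq_pos_of_ne_zero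
          (sub_ne_zero.mpr hne.symm))
        linarith
      have hcross : (V - U) * (V' - U') < 0 := by
        rw [← hQ', ← mul_assoc, mul_right_comm] at hviol
        exact neg_of_mul_neg_left hviol (sub_nonneg.mpr hraref.2.le)
      rw [hQ] at hviol ⊢
      exact abs_relFlux_sub_le_of_crossing hU hV hf hh hL hD hUD hUD' hVD hVD' hcross hviol
    linarith [laxTerm_eq_of_lt_of_lt hQ'.symm hraref.1 hraref.2]
  · linarith [laxTerm_le_of_not_lt_lt hQ'.symm hraref]

end FrontBalance

/-! ### Refinement of the positions of a step function -/

section Refinement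

variable {X E : Type*} [LinearOrder X] {n k : ℕ} {v : Fin k → X} {a : Fin n → Fin k} {g : X → E}
  {c : Fin (n + 1) → E}

/-- The cell of the positions `v ∘ a` that contains the `b`-th cell of the positions `v`. -/
def coarseCell (a : Fin n → Fin k) : Fin (k + 1) → Fin (n + 1) :=
  cellIndex fun i => (a i).succ

theorem coarseCell_castSucc (ha : StrictMono a) (i : Fin n) :
    coarseCell a (a i).castSucc = i.castSucc :=
  isStep_cellIndex _ _ _
    (fun _ hj => Fin.succ_le_castSucc_iff.mpr (ha (Fin.castSucc_lt_castSucc_iff.mp hj)))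
    fun _ hj => Fin.castSucc_lt_succ_iff.mpr (ha.monotone (Fin.castSucc_le_castSucc_iff.mp hj))

theorem coarseCell_succ (ha : StrictMono a) (i : Fin n) : coarseCell a (a i).succ = i.succ :=
  isStep_cellIndex _ _ _
    (fun _ hj => Fin.succ_le_succ_iff.mpr (ha.monotone (Fin.castSucc_lt_succ_iff.mp hj)))
    fun _ hj => Fin.succ_lt_succ_iff.mpr (ha (Fin.succ_le_castSucc_iff.mp hj))

theorem coarseCell_castSucc_eq_succ {b : Fin k} (hb : b ∉ range a) :
    coarseCell a b.castSucc = coarseCell a b.succ := by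
  have hne : ∀ i, a i ≠ b := fun i hi => hb ⟨i, hi⟩
  have hiff : ∀ i, (a i).succ ≤ b.castSucc ↔ (a i).succ ≤ b.succ := fun i => by
    rw [Fin.succ_le_castSucc_iff, Fin.succ_le_succ_iff, (hne i).le_iff_lt]
  simp only [coarseCell, cellIndex, hiff]

theorem IsStep.refine (hg : IsStep g (v ∘ a) c) (ha : Monotone a) :
    IsStep g v (c ∘ coarseCell a) := fun x b hl hr => by
  have hcell : ∀ i, i.castSucc < coarseCell a b ↔ (a i).castSucc < b := fun i => by
    rw [coarseCell, castSucc_lt_cellIndex_iff fun _ _ hij => Fin.succ_le_succ_iff.mpr (ha hij),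
      Fin.castSucc_lt_iff_succ_le]
  exact hg x _ (fun i hi => hl _ ((hcell i).mp hi))
    fun i hi => hr _ (not_lt.mp fun hlt => hi.not_gt ((hcell i).mpr hlt))

theorem eVariationOn_comp_coarseCell_le [PseudoEMetricSpace E] (c : Fin (n + 1) → E)
    (a : Fin n → Fin k) : eVariationOn (c ∘ coarseCell a) univ ≤ eVariationOn c univ :=
  eVariationOn.comp_le_of_monotoneOn c _ ((cellIndex_mono _).monotoneOn _) (mapsTo_univ _ _)

end Refinement

/-! ### Strips of non-intersecting fronts -/

section Lines

/-- The position at time `t` on the line `p = (y, σ)` of position `y` at time `0` and speed `σ`. -/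
def lineAt (p : ℝ × ℝ) (t : ℝ) : ℝ := p.1 + p.2 * t

@[fun_prop]
theorem continuous_lineAt (p : ℝ × ℝ) : Continuous (lineAt p) := by
  unfold lineAt
  fun_prop

variable {α β : ℝ}

theorem lineAt_lt_of_isPreconnected {S : Set ℝ} (hS : IsPreconnected S) {p q : ℝ × ℝ}
    (hpq : ∀ t ∈ S, lineAt p t ≠ lineAt q t) {m t : ℝ} (hm : m ∈ S) (ht : t ∈ S)
    (hlt : lineAt p m < lineAt q m) : lineAt p t < lineAt q t := by
  by_contra hle
  obtain ⟨s, hs, heq⟩ := hS.intermediate_value₂ hm ht (continuous_lineAt p).continuousOn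
    (continuous_lineAt q).continuousOn hlt.le (not_lt.mp hle)
  exact hpq s hs heq

theorem exists_sorted_lines {ι : Type*} [Finite ι] (P : ι → ℝ × ℝ) {S : Set ℝ}
    (hS : IsPreconnected S) (hne : S.Nonempty)
    (hP : ∀ i j, P i = P j ∨ ∀ t ∈ S, lineAt (P i) t ≠ lineAt (P j) t) :
    ∃ (k : ℕ) (q : Fin k → ℝ × ℝ) (ρ : ι → Fin k),
      (∀ t ∈ S, StrictMono fun j => lineAt (q j) t) ∧ ∀ i, q (ρ i) = P i := by
  obtain ⟨m, hm⟩ := hne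
  obtain ⟨k, φ, ρ, hφ, hsurj, hρ⟩ := exists_strictMono_factor fun i => lineAt (P i) m
  choose r hr using hsurj
  have hpos : ∀ j, lineAt (P (r j)) m = φ j := fun j => by rw [← hρ, hr]
  refine ⟨k, P ∘ r, ρ, fun t ht i j hij => ?_, fun i => ?_⟩
  · have hlt : lineAt (P (r i)) m < lineAt (P (r j)) m := by rw [hpos, hpos]; exact hφ hij
    have hdisjoint := (hP (r i) (r j)).resolve_left fun heq => hlt.ne (by rw [heq])
    exact lineAt_lt_of_isPreconnected hS hdisjoint hm ht hlt
  · exact (hP _ _).resolve_right fun hdisjoint => hdisjoint m hm (by rw [hpos, hρ])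

theorem monotone_lineAt {n : ℕ} {p : Fin n → ℝ × ℝ} (hαβ : α < β)
    (hp : ∀ t ∈ Ioo α β, StrictMono fun j => lineAt (p j) t) {t : ℝ} (ht : t ∈ Icc α β) :
    Monotone fun j => lineAt (p j) t := fun _ _ hij =>
  le_on_closure (s := Ioo α β) (fun s hs => (hp s hs).monotone hij)
    (continuous_lineAt _).continuousOn (continuous_lineAt _).continuousOn
    ((closure_Ioo hαβ.ne).symm ▸ ht)

end Lines

section Strip

/-- For times in `[α, β]`, `u` is piecewise constant, with fronts along the lines `p j`, which do
not meet for times in `(α, β)`. Unlike in `IsFrontStrip`, fronts without a jump are admitted. -/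
structure IsAdmissibleStrip (f : ℝ → ℝ) (h : ℝ) (u : ℝ → ℝ → ℝ) (α β : ℝ) {n : ℕ}
    (p : Fin n → ℝ × ℝ) (c : Fin (n + 1) → ℝ) : Prop where
  ordered : ∀ t ∈ Ioo α β, StrictMono fun j => lineAt (p j) t
  step : ∀ t ∈ Icc α β, IsStep (fun x => u x t) (fun j => lineAt (p j) t) c
  front : ∀ j, IsAdmissibleFront f h (p j).2 (c j.castSucc) (c j.succ)

variable {f : ℝ → ℝ} {h : ℝ} {u v : ℝ → ℝ → ℝ} {α β : ℝ} {n m : ℕ}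
  {p : Fin n → ℝ × ℝ} {c : Fin (n + 1) → ℝ} {p' : Fin m → ℝ × ℝ} {c' : Fin (m + 1) → ℝ}

theorem IsAdmissibleStrip.mono {α' β' : ℝ} (hu : IsAdmissibleStrip f h u α β p c) (hα : α ≤ α')
    (hβ : β' ≤ β) : IsAdmissibleStrip f h u α' β' p c where
  ordered t ht := hu.ordered t (Ioo_subset_Ioo hα hβ ht)
  step t ht := hu.step t (Icc_subset_Icc hα hβ ht)
  front := hu.front

theorem IsAdmissibleStrip.range_subset (hu : IsAdmissibleStrip f h u α β p c) {t : ℝ}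
    (ht : t ∈ Ioo α β) : range c ⊆ range fun x => u x t :=
  (hu.step t (Ioo_subset_Icc_self ht)).range_subset_range (hu.ordered t ht)

theorem IsFrontStrip.isAdmissibleStrip {τ : ℝ} {I : Set ℝ} {y σ : Fin n → ℝ}
    (hu : IsFrontStrip f h u τ I y σ c) (hI : Icc α β ⊆ I) :
    IsAdmissibleStrip f h u α β (fun j => (y j - σ j * τ, σ j)) c := by
  have hline : ∀ j t, lineAt (y j - σ j * τ, σ j) t = y j + σ j * (t - τ) := fun j t => by
    unfold lineAt
    ring
  refine ⟨fun t ht => ?_, fun t ht => ?_, fun j => ⟨?_, hu.shock_or_small j⟩⟩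
  · simp only [hline]
    exact hu.ordered t (interior_maximal (Ioo_subset_Icc_self.trans hI) isOpen_Ioo ht)
  · simp only [hline]
    exact hu.value t (hI ht)
  · unfold relFlux
    linear_combination -hu.rankineHugoniot j

theorem IsAdmissibleStrip.refine (hu : IsAdmissibleStrip f h u α β p c) (hαβ : α < β) {k : ℕ}
    {q : Fin k → ℝ × ℝ} (hq : ∀ t ∈ Ioo α β, StrictMono fun j => lineAt (q j) t) {a : Fin n → Fin k}
    (ha : ∀ i, q (a i) = p i) : IsAdmissibleStrip f h u α β q (c ∘ coarseCell a) := by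
  obtain rfl : q ∘ a = p := funext ha
  obtain ⟨t₀, ht₀⟩ := nonempty_Ioo.mpr hαβ
  have ha_mono : StrictMono a := fun _ _ hij => (hq t₀ ht₀).lt_iff_lt.mp (hu.ordered t₀ ht₀ hij)
  refine ⟨hq, fun t ht => (hu.step t ht).refine ha_mono.monotone, fun b => ?_⟩
  by_cases hb : b ∈ range a
  · obtain ⟨i, rfl⟩ := hb
    simp only [Function.comp_apply, coarseCell_castSucc ha_mono, coarseCell_succ ha_mono]
    exact hu.front i
  · simp only [Function.comp_apply, coarseCell_castSucc_eq_succ hb]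
    exact IsAdmissibleFront.refl _ _ _ _

theorem IsAdmissibleStrip.exists_common_refinement (hu : IsAdmissibleStrip f h u α β p c)
    (hv : IsAdmissibleStrip f h v α β p' c') (hαβ : α < β)
    (hpp' : ∀ i j, p i = p' j ∨ ∀ t ∈ Ioo α β, lineAt (p i) t ≠ lineAt (p' j) t) :
    ∃ (k : ℕ) (q : Fin k → ℝ × ℝ) (U V : Fin (k + 1) → ℝ),
      IsAdmissibleStrip f h u α β q U ∧ IsAdmissibleStrip f h v α β q V ∧
      eVariationOn U univ ≤ eVariationOn c univ ∧ eVariationOn V univ ≤ eVariationOn c' univ := by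
  have hself : ∀ {l} {r : Fin l → ℝ × ℝ}, (∀ t ∈ Ioo α β, StrictMono fun j => lineAt (r j) t) →
      ∀ i j, r i = r j ∨ ∀ t ∈ Ioo α β, lineAt (r i) t ≠ lineAt (r j) t := fun hr i j =>
    (eq_or_ne i j).imp (congrArg _) fun hij t ht => (hr t ht).injective.ne hij
  obtain ⟨k, q, ρ, hq, hρ⟩ := exists_sorted_lines (Sum.elim p p') isPreconnected_Ioo
    (nonempty_Ioo.mpr hαβ) (by
      rintro (i | i) (j | j)
      · exact hself hu.ordered i j
      · exact hpp' i j
      · exact (hpp' j i).imp Eq.symm fun hne t ht => (hne t ht).symm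
      · exact hself hv.ordered i j)
  exact ⟨k, q, _, _, hu.refine hαβ hq fun i => hρ (Sum.inl i),
    hv.refine hαβ hq fun j => hρ (Sum.inr j), eVariationOn_comp_coarseCell_le _ _,
    eVariationOn_comp_coarseCell_le _ _⟩

end Strip

/-! ### Lax discontinuities of the averaging coefficient -/

section LocalStructure

variable {g : ℝ → ℝ → ℝ} {x t σ l r : ℝ}

/-- Near `(x, t)`, `g` is equal to `l` on the left, and to `r` on the right, of the line of speed
`σ` through `(x, t)`. This is `IsJumpWithSpeed` with prescribed states, which may coincide. -/
def HasSides (g : ℝ → ℝ → ℝ) (x t σ l r : ℝ) : Prop :=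
  ∀ᶠ p : ℝ × ℝ in 𝓝 (x, t),
    (p.1 < x + σ * (p.2 - t) → g p.1 p.2 = l) ∧ (x + σ * (p.2 - t) < p.1 → g p.1 p.2 = r)

theorem HasSides.eventually_slice (H : HasSides g x t σ l r) :
    ∀ᶠ y in 𝓝 x, (y < x → g y t = l) ∧ (x < y → g y t = r) := by
  have hslice : ContinuousAt (fun y : ℝ => (y, t)) x := by fun_prop
  simpa using hslice.eventually H

theorem HasSides.leftTrace_eq (H : HasSides g x t σ l r) : leftTrace g x t = l := by
  refine leftLim_eq_of_tendsto (tendsto_const_nhds.congr' ?_)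
  filter_upwards [H.eventually_slice.filter_mono nhdsWithin_le_nhds, self_mem_nhdsWithin]
    with y hy hyx using (hy.1 hyx).symm

theorem HasSides.rightTrace_eq (H : HasSides g x t σ l r) : rightTrace g x t = r := by
  refine rightLim_eq_of_tendsto (tendsto_const_nhds.congr' ?_)
  filter_upwards [H.eventually_slice.filter_mono nhdsWithin_le_nhds, self_mem_nhdsWithin]
    with y hy hyx using (hy.2 hyx).symm

theorem HasSides.jumpSpeed_eq (H : HasSides g x t σ l r) (hlr : l ≠ r) : jumpSpeed g x t = σ := by
  have hex : ∃ σ, IsJumpWithSpeed g x t σ := ⟨σ, l, r, hlr, H⟩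
  rw [jumpSpeed, dif_pos hex]
  exact hex.choose_spec.unique ⟨l, r, hlr, H⟩

variable {α β : ℝ} {n : ℕ} {q : Fin n → ℝ × ℝ} {c : Fin (n + 1) → ℝ}

theorem eventually_lineAt_lt_iff (q : Fin n → ℝ × ℝ) (x t : ℝ) :
    ∀ᶠ p : ℝ × ℝ in 𝓝 (x, t), ∀ j, (lineAt (q j) t < x → lineAt (q j) p.2 < p.1) ∧
      (x < lineAt (q j) t → p.1 < lineAt (q j) p.2) := by
  have hline : ∀ j, ContinuousAt (fun p : ℝ × ℝ => lineAt (q j) p.2) (x, t) := fun j => by fun_prop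
  refine eventually_all.mpr fun j => .and (eventually_imp_distrib_left.mpr fun hlt => ?_)
    (eventually_imp_distrib_left.mpr fun hlt => ?_)
  · exact (hline j).eventually_lt continuousAt_fst hlt
  · exact continuousAt_fst.eventually_lt (hline j) hlt

theorem hasSides_of_front (hq : ∀ t ∈ Ioo α β, StrictMono fun j => lineAt (q j) t)
    (hg : ∀ t ∈ Icc α β, IsStep (fun x => g x t) (fun j => lineAt (q j) t) c) (ht : t ∈ Ioo α β)
    (b : Fin n) : HasSides g (lineAt (q b) t) t (q b).2 (c b.castSucc) (c b.succ) := by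
  filter_upwards [continuousAt_snd.eventually (isOpen_Ioo.mem_nhds ht),
    eventually_lineAt_lt_iff q (lineAt (q b) t) t] with p hp hpj
  have hline : lineAt (q b) t + (q b).2 * (p.2 - t) = lineAt (q b) p.2 := by unfold lineAt; ring
  have hleft : ∀ j < b, lineAt (q j) p.2 < p.1 := fun j hj => (hpj j).1 (hq t ht hj)
  have hright : ∀ j, b < j → p.1 < lineAt (q j) p.2 := fun j hj => (hpj j).2 (hq t ht hj)
  have hstep := hg p.2 (Ioo_subset_Icc_self hp) p.1
  rw [hline]
  refine ⟨fun hlt => hstep b.castSucc (fun j hj => ?_) fun j hj => ?_,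
    fun hlt => hstep b.succ (fun j hj => ?_) fun j hj => ?_⟩
  · exact (hleft j (Fin.castSucc_lt_castSucc_iff.mp hj)).le
  · rcases (Fin.castSucc_le_castSucc_iff.mp hj).eq_or_lt with rfl | hbj
    exacts [hlt, hright j hbj]
  · rcases (Fin.castSucc_lt_succ_iff.mp hj).eq_or_lt with rfl | hjb
    exacts [hlt.le, (hleft j hjb).le]
  · exact hright j (Fin.succ_le_castSucc_iff.mp hj)

theorem hasSides_self_of_forall_ne (hq : ∀ t ∈ Ioo α β, StrictMono fun j => lineAt (q j) t)
    (hg : ∀ t ∈ Icc α β, IsStep (fun x => g x t) (fun j => lineAt (q j) t) c) (ht : t ∈ Ioo α β)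
    (hx : ∀ j, lineAt (q j) t ≠ x) : HasSides g x t 0 (g x t) (g x t) := by
  filter_upwards [continuousAt_snd.eventually (isOpen_Ioo.mem_nhds ht),
    eventually_lineAt_lt_iff q x t] with p hp hpj
  have hiff : ∀ j, lineAt (q j) p.2 ≤ p.1 ↔ lineAt (q j) t ≤ x := fun j =>
    ⟨fun hle => not_lt.mp fun hlt => ((hpj j).2 hlt).not_ge hle,
      fun hle => ((hpj j).1 (hle.lt_of_ne (hx j))).le⟩
  have hconst : g p.1 p.2 = g x t := by
    rw [(hg p.2 (Ioo_subset_Icc_self hp)).eq_cellIndex (hq p.2 hp).monotone,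
      (hg t (Ioo_subset_Icc_self ht)).eq_cellIndex (hq t ht).monotone]
    simp only [cellIndex, hiff]
  exact ⟨fun _ => hconst, fun _ => hconst⟩

theorem exists_lineAt_eq_of_mem_laxSet (hq : ∀ t ∈ Ioo α β, StrictMono fun j => lineAt (q j) t)
    (hg : ∀ t ∈ Icc α β, IsStep (fun x => g x t) (fun j => lineAt (q j) t) c) (ht : t ∈ Ioo α β)
    (hx : (x, t) ∈ laxSet g) : ∃ b, lineAt (q b) t = x := by
  by_contra! hne
  have H := hasSides_self_of_forall_ne hq hg ht hne
  exact (hx.2.2.1.trans hx.2.2.2).ne (H.rightTrace_eq.trans H.leftTrace_eq.symm)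

variable {f : ℝ → ℝ} {h : ℝ} {u v : ℝ → ℝ → ℝ} {U V : Fin (n + 1) → ℝ}

theorem IsAdmissibleStrip.isStep_avgSpeed (hu : IsAdmissibleStrip f h u α β q U)
    (hv : IsAdmissibleStrip f h v α β q V) (ht : t ∈ Icc α β) :
    IsStep (fun x => avgSpeed f u v x t) (fun j => lineAt (q j) t) fun i => dslope f (U i) (V i) :=
  (hu.step t ht).comp₂ (hv.step t ht) (dslope f)

/-- The rate of dissipation at the `b`-th common front of two strips with states `U` and `V`. -/
noncomputable def stripLaxTerm (f : ℝ → ℝ) (q : Fin n → ℝ × ℝ) (U V : Fin (n + 1) → ℝ)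
    (b : Fin n) : ℝ :=
  laxTerm (dslope f (U b.castSucc) (V b.castSucc)) (dslope f (U b.succ) (V b.succ)) (q b).2
    (V b.castSucc - U b.castSucc)

theorem IsAdmissibleStrip.stripLaxTerm_eq (hu : IsAdmissibleStrip f h u α β q U)
    (hv : IsAdmissibleStrip f h v α β q V) (ht : t ∈ Ioo α β) {b : Fin n}
    (hb : (lineAt (q b) t, t) ∈ laxSet (avgSpeed f u v)) :
    stripLaxTerm f q U V b =
      2 * (leftTrace (avgSpeed f u v) (lineAt (q b) t) t
          - jumpSpeed (avgSpeed f u v) (lineAt (q b) t) t)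
        * |leftTrace v (lineAt (q b) t) t - leftTrace u (lineAt (q b) t) t| := by
  have Ha := hasSides_of_front hu.ordered (fun _ => hu.isStep_avgSpeed hv) ht b
  obtain ⟨-, -, hright, hleft⟩ := hb
  dsimp only at hright hleft
  rw [Ha.leftTrace_eq] at hleft ⊢
  rw [Ha.rightTrace_eq] at hright
  have hspeed := Ha.jumpSpeed_eq (hright.trans hleft).ne'
  rw [hspeed] at hleft hright ⊢
  rw [(hasSides_of_front hu.ordered hu.step ht b).leftTrace_eq,
    (hasSides_of_front hu.ordered hv.step ht b).leftTrace_eq, stripLaxTerm, laxTerm,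
    if_pos ⟨hright, hleft⟩]

theorem IsAdmissibleStrip.laxDissipation_le (hu : IsAdmissibleStrip f h u α β q U)
    (hv : IsAdmissibleStrip f h v α β q V) (ht : t ∈ Ioo α β) :
    laxDissipation (avgSpeed f u v) u v t ≤ ∑ b, ENNReal.ofReal (stripLaxTerm f q U V b) := by
  choose b hb using fun x : {x : ℝ // (x, t) ∈ laxSet (avgSpeed f u v)} =>
    exists_lineAt_eq_of_mem_laxSet hu.ordered (fun _ => hu.isStep_avgSpeed hv) ht x.2
  have hinj : Function.Injective b := fun x y hxy => Subtype.ext (by rw [← hb x, ← hb y, hxy])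
  calc laxDissipation (avgSpeed f u v) u v t
      = ∑' x, ENNReal.ofReal (stripLaxTerm f q U V (b x)) :=
        tsum_congr fun x => by rw [hu.stripLaxTerm_eq hv ht (by rw [hb]; exact x.2), hb]
    _ ≤ ∑' b, ENNReal.ofReal (stripLaxTerm f q U V b) :=
        ENNReal.tsum_comp_le_tsum_of_injective hinj _
    _ = ∑ b, ENNReal.ofReal (stripLaxTerm f q U V b) := tsum_fintype _

end LocalStructure

/-! ### The balance of the `L¹` distance -/

section Estimate

/-- The quantity `F` at the end of `[a, b]`, increased by the dissipation at the rate `D`, exceeds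
its value at the start by at most the error accumulated at the rate `R`. -/
def DissipationEstimate (F D : ℝ → ℝ≥0∞) (R : ℝ≥0∞) (a b : ℝ) : Prop :=
  F b + ∫⁻ τ in Icc a b, D τ ≤ F a + ENNReal.ofReal (b - a) * R

variable {F D : ℝ → ℝ≥0∞} {R R' : ℝ≥0∞} {a b c : ℝ}

theorem DissipationEstimate.refl (F D : ℝ → ℝ≥0∞) (R : ℝ≥0∞) (a : ℝ) :
    DissipationEstimate F D R a a := by
  simp [DissipationEstimate]

theorem DissipationEstimate.mono_rate (H : DissipationEstimate F D R a b) (hR : R ≤ R') :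
    DissipationEstimate F D R' a b :=
  H.trans (by gcongr)

theorem DissipationEstimate.trans (hab : a ≤ b) (hbc : b ≤ c) (H₁ : DissipationEstimate F D R a b)
    (H₂ : DissipationEstimate F D R b c) : DissipationEstimate F D R a c := by
  unfold DissipationEstimate at *
  calc F c + ∫⁻ τ in Icc a c, D τ
      ≤ F c + ((∫⁻ τ in Icc a b, D τ) + ∫⁻ τ in Icc b c, D τ) := by
        rw [← Icc_union_Icc_eq_Icc hab hbc]
        gcongr
        exact lintegral_union_le _ _ _
    _ = (F c + ∫⁻ τ in Icc b c, D τ) + ∫⁻ τ in Icc a b, D τ := by ring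
    _ ≤ (F b + ENNReal.ofReal (c - b) * R) + ∫⁻ τ in Icc a b, D τ := by gcongr
    _ = (F b + ∫⁻ τ in Icc a b, D τ) + ENNReal.ofReal (c - b) * R := by ring
    _ ≤ (F a + ENNReal.ofReal (b - a) * R) + ENNReal.ofReal (c - b) * R := by gcongr
    _ = F a + ENNReal.ofReal (c - a) * R := by
        rw [add_assoc, ← add_mul, ← ENNReal.ofReal_add (sub_nonneg.mpr hab) (sub_nonneg.mpr hbc)]
        ring_nf

theorem DissipationEstimate.of_finite {B : Set ℝ} (hB : B.Finite) (hab : a ≤ b)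
    (H : ∀ a' b', a ≤ a' → a' < b' → b' ≤ b → Disjoint (Ioo a' b') B →
      DissipationEstimate F D R a' b') : DissipationEstimate F D R a b := by
  induction B, hB using Set.Finite.induction_on generalizing a b with
  | empty =>
    rcases hab.eq_or_lt with rfl | hab
    exacts [.refl .., H a b le_rfl hab le_rfl (disjoint_empty _)]
  | @insert s B _ _ ih =>
    have hsub : ∀ {a₁ b₁}, a ≤ a₁ → a₁ ≤ b₁ → b₁ ≤ b → s ∉ Ioo a₁ b₁ →
        DissipationEstimate F D R a₁ b₁ := fun ha₁ hab₁ hb₁ hs =>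
      ih hab₁ fun a' b' ha' hab' hb' hdisj => H a' b' (ha₁.trans ha') hab' (hb'.trans hb₁)
        (disjoint_insert_right.mpr ⟨fun hs' => hs (Ioo_subset_Ioo ha' hb' hs'), hdisj⟩)
    by_cases hs : s ∈ Ioo a b
    · exact .trans hs.1.le hs.2.le (hsub le_rfl hs.1.le hs.2.le fun hs' => lt_irrefl _ hs'.2)
        (hsub hs.1.le hs.2.le le_rfl fun hs' => lt_irrefl _ hs'.1)
    · exact hsub le_rfl hab le_rfl hs

end Estimate

section StripBalance

variable {f : ℝ → ℝ} {h : ℝ} {u v : ℝ → ℝ → ℝ} {α β t : ℝ} {n : ℕ} {q : Fin n → ℝ × ℝ}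
  {U V : Fin (n + 1) → ℝ}

theorem IsAdmissibleStrip.ends_eq_of_l1Dist_ne_top (hu : IsAdmissibleStrip f h u α β q U)
    (hv : IsAdmissibleStrip f h v α β q V) (ht : t ∈ Icc α β) (hfin : l1Dist u v t ≠ ∞) :
    U 0 = V 0 ∧ U (Fin.last n) = V (Fin.last n) := by
  rw [l1Dist, eLpNorm_one_eq_lintegral_enorm] at hfin
  have hstep := (hu.step t ht).comp₂ (hv.step t ht) fun a b => b - a
  obtain ⟨hfirst, hlast⟩ := hstep.eq_zero_of_lintegral_enorm_ne_top hfin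
  exact ⟨(sub_eq_zero.mp hfirst).symm, (sub_eq_zero.mp hlast).symm⟩

/-- The `L¹` distance at time `t` of two strips with common fronts `q` and states `U` and `V`,
in terms of the positions of the fronts. -/
noncomputable def stripDist (q : Fin n → ℝ × ℝ) (U V : Fin (n + 1) → ℝ) (t : ℝ) : ℝ :=
  ∑ j, lineAt (q j) t * (|V j.castSucc - U j.castSucc| - |V j.succ - U j.succ|)

theorem stripDist_eq_add (q : Fin n → ℝ × ℝ) (U V : Fin (n + 1) → ℝ) (α β : ℝ) :
    stripDist q U V β = stripDist q U V α
      + (β - α) * ∑ j, (q j).2 * (|V j.castSucc - U j.castSucc| - |V j.succ - U j.succ|) := by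
  simp only [stripDist, Finset.mul_sum, ← Finset.sum_add_distrib, lineAt]
  exact Finset.sum_congr rfl fun j _ => by ring

theorem IsAdmissibleStrip.l1Dist_eq (hu : IsAdmissibleStrip f h u α β q U)
    (hv : IsAdmissibleStrip f h v α β q V) (hαβ : α < β) (hfirst : U 0 = V 0)
    (hlast : U (Fin.last n) = V (Fin.last n)) (ht : t ∈ Icc α β) :
    0 ≤ stripDist q U V t ∧ l1Dist u v t = ENNReal.ofReal (stripDist q U V t) := by
  have hstep := (hu.step t ht).comp₂ (hv.step t ht) fun a b => |b - a|
  have hmono := monotone_lineAt hαβ hu.ordered ht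
  have hfirst' : |V 0 - U 0| = 0 := by rw [hfirst, sub_self, abs_zero]
  have hlast' : |V (Fin.last n) - U (Fin.last n)| = 0 := by rw [hlast, sub_self, abs_zero]
  have hdist : ∫ x, |v x t - u x t| = stripDist q U V t :=
    hstep.integral_eq hmono hfirst' hlast'
  rw [← hdist]
  refine ⟨integral_nonneg fun x => abs_nonneg _, ?_⟩
  rw [l1Dist, eLpNorm_one_eq_lintegral_enorm, ofReal_integral_eq_lintegral_ofReal
    (hstep.integrable hmono hfirst' hlast') (.of_forall fun x => abs_nonneg _)]
  simp only [← ofReal_norm, Real.norm_eq_abs]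

theorem stripLaxTerm_nonneg (f : ℝ → ℝ) (q : Fin n → ℝ × ℝ) (U V : Fin (n + 1) → ℝ) (b : Fin n) :
    0 ≤ stripLaxTerm f q U V b :=
  laxTerm_nonneg _ _ _ _

theorem IsAdmissibleStrip.lintegral_laxDissipation_le (hu : IsAdmissibleStrip f h u α β q U)
    (hv : IsAdmissibleStrip f h v α β q V) :
    ∫⁻ τ in Icc α β, laxDissipation (avgSpeed f u v) u v τ
      ≤ ENNReal.ofReal ((β - α) * ∑ b, stripLaxTerm f q U V b) := by
  have hsum : 0 ≤ ∑ b, stripLaxTerm f q U V b :=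
    Finset.sum_nonneg fun b _ => stripLaxTerm_nonneg f q U V b
  calc ∫⁻ τ in Icc α β, laxDissipation (avgSpeed f u v) u v τ
      = ∫⁻ τ in Ioo α β, laxDissipation (avgSpeed f u v) u v τ := by
        rw [restrict_Ioo_eq_restrict_Icc]
    _ ≤ ∫⁻ _ in Ioo α β, ∑ b, ENNReal.ofReal (stripLaxTerm f q U V b) :=
        setLIntegral_mono' measurableSet_Ioo fun τ hτ => hu.laxDissipation_le hv hτ
    _ = ENNReal.ofReal ((β - α) * ∑ b, stripLaxTerm f q U V b) := by
        rw [setLIntegral_const, Real.volume_Ioo, ENNReal.ofReal_mul' hsum, mul_comm,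
          ENNReal.ofReal_sum_of_nonneg fun b _ => stripLaxTerm_nonneg f q U V b]

variable {S : Set ℝ} {L : ℝ≥0}

theorem IsAdmissibleStrip.sum_front_balance (hf : Differentiable ℝ f) (hh : 0 ≤ h)
    (hL : LipschitzOnWith L (deriv f) S) (hS : Convex ℝ S)
    (hu : IsAdmissibleStrip f h u α β q U) (hv : IsAdmissibleStrip f h v α β q V)
    (hUS : range U ⊆ S) (hVS : range V ⊆ S) (hfirst : U 0 = V 0)
    (hlast : U (Fin.last n) = V (Fin.last n)) :
    (∑ b : Fin n, (q b).2 * (|V b.castSucc - U b.castSucc| - |V b.succ - U b.succ|))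
        + ∑ b, stripLaxTerm f q U V b
      ≤ 2 * h * L * ∑ b : Fin n, (|U b.succ - U b.castSucc| + |V b.succ - V b.castSucc|) := by
  rw [range_subset_iff] at hUS hVS
  let flux : Fin (n + 1) → ℝ := fun i => dslope f (U i) (V i) * |V i - U i|
  have htelescope : ∑ b : Fin n, (flux b.castSucc - flux b.succ) = 0 := by
    have hfluxes : flux (Fin.last n) = 0 ∧ flux 0 = 0 := by simp [flux, hfirst, hlast]
    rw [← neg_eq_zero, ← Finset.sum_neg_distrib]
    simp only [neg_sub]
    rw [sum_succ_sub_castSucc, hfluxes.1, hfluxes.2, sub_zero]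
  calc _ = ∑ b : Fin n, ((q b).2 * (|V b.castSucc - U b.castSucc| - |V b.succ - U b.succ|)
          + stripLaxTerm f q U V b) := Finset.sum_add_distrib.symm
    _ ≤ ∑ b : Fin n, (flux b.castSucc - flux b.succ
          + 2 * h * L * (|U b.succ - U b.castSucc| + |V b.succ - V b.castSucc|)) :=
        Finset.sum_le_sum fun b _ => front_balance (hu.front b) (hv.front b) hf hh hL hS
          (hUS _) (hUS _) (hVS _) (hVS _)
    _ = _ := by rw [Finset.sum_add_distrib, htelescope, zero_add, Finset.mul_sum]

theorem eVariationOn_fin_real_add (U V : Fin (n + 1) → ℝ) :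
    eVariationOn U univ + eVariationOn V univ
      = ENNReal.ofReal (∑ b : Fin n, (|U b.succ - U b.castSucc| + |V b.succ - V b.castSucc|)) := by
  rw [eVariationOn_fin_real, eVariationOn_fin_real, ← ENNReal.ofReal_add (by positivity)
    (by positivity), ← Finset.sum_add_distrib]

theorem IsAdmissibleStrip.dissipationEstimate (hf : Differentiable ℝ f) (hh : 0 ≤ h)
    (hL : LipschitzOnWith L (deriv f) S) (hS : Convex ℝ S) (hαβ : α < β)
    (hu : IsAdmissibleStrip f h u α β q U) (hv : IsAdmissibleStrip f h v α β q V)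
    (hUS : range U ⊆ S) (hVS : range V ⊆ S) :
    DissipationEstimate (l1Dist u v) (laxDissipation (avgSpeed f u v) u v)
      (ENNReal.ofReal (2 * h) * L * (eVariationOn U univ + eVariationOn V univ)) α β := by
  unfold DissipationEstimate
  have hα : α ∈ Icc α β := left_mem_Icc.mpr hαβ.le
  by_cases hfin : l1Dist u v α = ∞
  · rw [hfin, top_add]
    exact le_top
  obtain ⟨hfirst, hlast⟩ := hu.ends_eq_of_l1Dist_ne_top hv hα hfin
  obtain ⟨-, hdistα⟩ := hu.l1Dist_eq hv hαβ hfirst hlast hα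
  obtain ⟨hdistβ_nonneg, hdistβ⟩ :=
    hu.l1Dist_eq hv hαβ hfirst hlast (right_mem_Icc.mpr hαβ.le)
  have hbalance := hu.sum_front_balance hf hh hL hS hv hUS hVS hfirst hlast
  have hlax : 0 ≤ ∑ b, stripLaxTerm f q U V b :=
    Finset.sum_nonneg fun b _ => stripLaxTerm_nonneg f q U V b
  set TV := ∑ b : Fin n, (|U b.succ - U b.castSucc| + |V b.succ - V b.castSucc|)
  have hβα : 0 ≤ β - α := sub_nonneg.mpr hαβ.le
  have hrate : ENNReal.ofReal (2 * h) * L * (eVariationOn U univ + eVariationOn V univ)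
      = ENNReal.ofReal (2 * h * L * TV) := by
    rw [eVariationOn_fin_real_add, ENNReal.ofReal_mul (p := 2 * h * L) (by positivity),
      ENNReal.ofReal_mul (p := 2 * h) (by positivity), ENNReal.ofReal_coe_nnreal]
  calc l1Dist u v β + ∫⁻ τ in Icc α β, laxDissipation (avgSpeed f u v) u v τ
      ≤ ENNReal.ofReal (stripDist q U V β)
          + ENNReal.ofReal ((β - α) * ∑ b, stripLaxTerm f q U V b) := by
        rw [hdistβ]
        gcongr
        exact hu.lintegral_laxDissipation_le hv
    _ = ENNReal.ofReal (stripDist q U V β + (β - α) * ∑ b, stripLaxTerm f q U V b) :=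
        (ENNReal.ofReal_add hdistβ_nonneg (mul_nonneg hβα hlax)).symm
    _ ≤ ENNReal.ofReal (stripDist q U V α + (β - α) * (2 * h * L * TV)) := by
        rw [stripDist_eq_add q U V α β, add_assoc, ← mul_add]
        gcongr
    _ ≤ ENNReal.ofReal (stripDist q U V α) + ENNReal.ofReal ((β - α) * (2 * h * L * TV)) :=
        ENNReal.ofReal_add_le
    _ = _ := by rw [hrate, hdistα, ENNReal.ofReal_mul hβα]

end StripBalance

/-! ### Decomposition in time -/

section Time

variable {f : ℝ → ℝ} {h : ℝ} {u v : ℝ → ℝ → ℝ} {α β : ℝ} {n m : ℕ}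

theorem subsingleton_setOf_lineAt_eq {p q : ℝ × ℝ} (hpq : p ≠ q) :
    {t | lineAt p t = lineAt q t}.Subsingleton := by
  intro s hs t ht
  simp only [mem_ofPred_eq, lineAt] at hs ht
  by_contra hst
  have hspeed : p.2 = q.2 :=
    mul_right_cancel₀ (sub_ne_zero.mpr hst) (by linear_combination hs - ht)
  exact hpq (Prod.ext (by linear_combination hs - s * hspeed) hspeed)

theorem IsAdmissibleStrip.dissipationEstimate_of_crossings {p : Fin n → ℝ × ℝ}
    {c : Fin (n + 1) → ℝ} {p' : Fin m → ℝ × ℝ} {c' : Fin (m + 1) → ℝ} {S : Set ℝ} {L : ℝ≥0}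
    (hf : Differentiable ℝ f) (hh : 0 ≤ h) (hL : LipschitzOnWith L (deriv f) S) (hS : Convex ℝ S)
    (hαβ : α ≤ β) (hu : IsAdmissibleStrip f h u α β p c) (hv : IsAdmissibleStrip f h v α β p' c')
    (huS : ∀ t ∈ Icc α β, ∀ x, u x t ∈ S) (hvS : ∀ t ∈ Icc α β, ∀ x, v x t ∈ S) :
    DissipationEstimate (l1Dist u v) (laxDissipation (avgSpeed f u v) u v)
      (ENNReal.ofReal (2 * h) * L * (eVariationOn c univ + eVariationOn c' univ)) α β := by
  have hcrossings : (⋃ i, ⋃ j, ⋃ _ : p i ≠ p' j, {t | lineAt (p i) t = lineAt (p' j) t}).Finite :=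
    finite_iUnion fun i => finite_iUnion fun j => finite_iUnion fun hne =>
      (subsingleton_setOf_lineAt_eq hne).finite
  refine .of_finite hcrossings hαβ fun a b hαa hab hbβ hdisj => ?_
  obtain ⟨k, q, U, V, hU, hV, hUc, hVc⟩ :=
    (hu.mono hαa hbβ).exists_common_refinement (hv.mono hαa hbβ) hab fun i j =>
      or_iff_not_imp_left.mpr fun hne t ht heq => disjoint_left.mp hdisj ht <| by
        simp only [mem_iUnion]
        exact ⟨i, j, hne, heq⟩
  obtain ⟨t, ht⟩ := nonempty_Ioo.mpr hab
  have htαβ : t ∈ Icc α β := ⟨hαa.trans ht.1.le, ht.2.le.trans hbβ⟩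
  refine (hU.dissipationEstimate hf hh hL hS hab hV ((hU.range_subset ht).trans ?_)
    ((hV.range_subset ht).trans ?_)).mono_rate (by gcongr)
  exacts [range_subset_iff.mpr (huS t htαβ), range_subset_iff.mpr (hvS t htαβ)]

variable {τ τ' : ℝ} {I : Set ℝ} {y σ : Fin n → ℝ} {c : Fin (n + 1) → ℝ}

theorem IsFrontStrip.eVariationOn_le_totalVariation (hu : IsFrontStrip f h u τ I y σ c)
    (hτ : τ < τ') (hI : Icc τ τ' ⊆ I) : eVariationOn c univ ≤ totalVariation u τ := by
  have hstrip := hu.isAdmissibleStrip hI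
  have hmem : τ ∈ Icc τ τ' := left_mem_Icc.mpr hτ.le
  refine (hstrip.step τ hmem).le_eVariationOn (monotone_lineAt hτ hstrip.ordered hmem)
    fun i j hij => hu.fan i j ?_
  simpa [lineAt] using hij

theorem IsFrontStrip.totalVariation_le (hu : IsFrontStrip f h u τ I y σ c) (hτ : τ < τ')
    (hI : Icc τ τ' ⊆ I) : totalVariation u τ' ≤ totalVariation u τ := by
  have hstrip := hu.isAdmissibleStrip hI
  have hmem : τ' ∈ Icc τ τ' := right_mem_Icc.mpr hτ.le
  exact ((hstrip.step τ' hmem).eVariationOn_le (monotone_lineAt hτ hstrip.ordered hmem)).trans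
    (hu.eVariationOn_le_totalVariation hτ hI)

/-- The time interval number `k` of a front-tracking approximation with interaction times
`T 0, …, T N`. -/
def stage (T : ℕ → ℝ) (N k : ℕ) : Set ℝ :=
  if k < N then Icc (T k) (T (k + 1)) else Ici (T k)

theorem exists_mem_Icc_subset_stage {T : ℕ → ℝ} {N k : ℕ} (hT : ∀ k < N, T k < T (k + 1)) {t : ℝ}
    (ht : t ∈ stage T N k) : ∃ τ', T k < τ' ∧ t ∈ Icc (T k) τ' ∧ Icc (T k) τ' ⊆ stage T N k := by
  unfold stage at *
  split_ifs at * with hk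
  · exact ⟨_, hT k hk, ht, Subset.rfl⟩
  · exact ⟨t + 1, lt_add_of_le_of_pos ht one_pos, ⟨ht, (lt_add_one t).le⟩, Icc_subset_Ici_self⟩

theorem exists_Icc_subset_stage_of_disjoint {T : ℕ → ℝ} {N : ℕ} (hα : T 0 ≤ α)
    (hdisj : Disjoint (Ioo α β) (T '' Iic N)) : ∃ k ≤ N, Icc α β ⊆ stage T N k := by
  set k := Nat.findGreatest (fun k => T k ≤ α) N
  have hkN : k ≤ N := Nat.findGreatest_le N
  have hkα : T k ≤ α := Nat.findGreatest_spec (P := fun k => T k ≤ α) (Nat.zero_le N) hα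
  refine ⟨k, hkN, fun t ht => ?_⟩
  unfold stage
  split_ifs with hlt
  · have hαk : α < T (k + 1) :=
      not_le.mp (Nat.findGreatest_is_greatest (P := fun k => T k ≤ α) k.lt_succ_self hlt)
    have hkβ : ¬ T (k + 1) < β := fun hlt' =>
      disjoint_left.mp hdisj ⟨hαk, hlt'⟩ (mem_image_of_mem T (mem_Iic.mpr hlt))
    exact ⟨hkα.trans ht.1, ht.2.trans (not_lt.mp hkβ)⟩
  · exact hkα.trans ht.1

theorem IsFrontTracking.exists_stages (hu : IsFrontTracking f h u) :
    ∃ (N : ℕ) (T : ℕ → ℝ), T 0 = 0 ∧ (∀ k < N, T k < T (k + 1)) ∧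
      ∀ k ≤ N, ∃ (n : ℕ) (y σ : Fin n → ℝ) (c : Fin (n + 1) → ℝ),
        IsFrontStrip f h u (T k) (stage T N k) y σ c := by
  obtain ⟨N, T, hT0, hT, hstrip, hlast⟩ := hu
  refine ⟨N, T, hT0, hT, fun k hk => ?_⟩
  unfold stage
  split_ifs with hlt
  · exact hstrip k hlt
  · obtain rfl : k = N := hk.antisymm (not_lt.mp hlt)
    exact hlast

theorem IsFrontTracking.exists_finite_strips (hu : IsFrontTracking f h u) :
    ∃ B : Set ℝ, B.Finite ∧ ∀ α β, 0 ≤ α → α ≤ β → Disjoint (Ioo α β) B →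
      ∃ (n : ℕ) (p : Fin n → ℝ × ℝ) (c : Fin (n + 1) → ℝ),
        IsAdmissibleStrip f h u α β p c ∧ eVariationOn c univ ≤ totalVariation u 0 := by
  obtain ⟨N, T, hT0, hT, hstrip⟩ := hu.exists_stages
  have hTV : ∀ k ≤ N, totalVariation u (T k) ≤ totalVariation u 0 := by
    intro k
    induction k with
    | zero => exact fun _ => by rw [hT0]
    | succ k ih =>
      intro hk
      obtain ⟨n, y, σ, c, hc⟩ := hstrip k (Nat.le_of_succ_le hk)
      exact (hc.totalVariation_le (hT k hk) (if_pos (Nat.lt_of_succ_le hk)).superset).trans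
        (ih (Nat.le_of_succ_le hk))
  refine ⟨T '' Iic N, (finite_Iic N).image T, fun α β hα hαβ hdisj => ?_⟩
  obtain ⟨k, hkN, hsub⟩ := exists_Icc_subset_stage_of_disjoint (hT0.trans_le hα) hdisj
  obtain ⟨n, y, σ, c, hc⟩ := hstrip k hkN
  obtain ⟨τ', hτ', -, hsub'⟩ := exists_mem_Icc_subset_stage hT (hsub (left_mem_Icc.mpr hαβ))
  exact ⟨n, _, c, hc.isAdmissibleStrip hsub,
    (hc.eVariationOn_le_totalVariation hτ' hsub').trans (hTV k hkN)⟩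

theorem IsFrontTracking.finite_values (hu : IsFrontTracking f h u) :
    {z | ∃ x t, 0 ≤ t ∧ u x t = z}.Finite := by
  obtain ⟨N, T, hT0, hT, hstrip⟩ := hu.exists_stages
  choose n y σ c hc using hstrip
  refine ((finite_Iic N).biUnion' fun k hk => finite_range (c k hk)).subset ?_
  rintro _ ⟨x, t, ht, rfl⟩
  have hdisj : Disjoint (Ioo t t) (T '' Iic N) := by simp
  obtain ⟨k, hkN, hsub⟩ := exists_Icc_subset_stage_of_disjoint (hT0.trans_le ht) hdisj
  obtain ⟨τ', hτ', htk, hsub'⟩ := exists_mem_Icc_subset_stage hT (hsub (left_mem_Icc.mpr le_rfl))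
  have hc' := (hc k hkN).isAdmissibleStrip hsub'
  have hvalue := (hc'.step t htk).eq_cellIndex (monotone_lineAt hτ' hc'.ordered htk) x
  exact mem_iUnion₂.mpr ⟨k, hkN, _, hvalue.symm⟩

end Time

theorem exists_lipschitzOnWith_deriv_of_finite {f : ℝ → ℝ} (hf : ContDiff ℝ 2 f) {S C : Set ℝ}
    (hS : S.Finite) (hC : Convex ℝ C) (hSC : S ⊆ C) :
    ∃ (D : Set ℝ) (L : ℝ≥0), Convex ℝ D ∧ S ⊆ D ∧ LipschitzOnWith L (deriv f) D ∧
      (L : ℝ≥0∞) ≤ ⨆ w ∈ C, ‖deriv (deriv f) w‖ₑ := by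
  have hf' : ContDiff ℝ 1 (deriv f) := hf.iterate_deriv' 1 1
  have hD : Convex ℝ (convexHull ℝ S) := convex_convexHull ℝ S
  rcases S.eq_empty_or_nonempty with rfl | hne
  · exact ⟨∅, 0, convex_empty, Subset.rfl, lipschitzOnWith_empty .., by simp⟩
  obtain ⟨z, hzD, hz⟩ := (hS.isCompact_convexHull ℝ).exists_isMaxOn hne.convexHull
    (hf'.continuous_deriv le_rfl).nnnorm.continuousOn
  refine ⟨convexHull ℝ S, ‖deriv (deriv f) z‖₊, hD, subset_convexHull ℝ S, ?_, ?_⟩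
  · exact hD.lipschitzOnWith_of_nnnorm_deriv_le
      (fun w _ => (hf'.differentiable one_ne_zero).differentiableAt) fun w hw => hz hw
  · exact le_iSup₂_of_le z (convexHull_min hSC hC hzD) le_rfl

end FrontTracking

open FrontTracking NNReal in
theorem theorem3p1_general {f : ℝ → ℝ} (hf : Differentiable ℝ f) {h : ℝ} (hh : 0 ≤ h)
    {uI uII : ℝ → ℝ → ℝ} (hI : IsFrontTracking f h uI) (hII : IsFrontTracking f h uII)
    {C : Set ℝ} (hC : Convex ℝ C) (hCI : ∀ x t, 0 ≤ t → uI x t ∈ C)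
    (hCII : ∀ x t, 0 ≤ t → uII x t ∈ C) {L : ℝ≥0} (hL : LipschitzOnWith L (deriv f) C)
    {s t : ℝ} (hs : 0 ≤ s) (hst : s ≤ t) :
    l1Dist uI uII t + ∫⁻ τ in Icc s t, laxDissipation (avgSpeed f uI uII) uI uII τ
      ≤ l1Dist uI uII s
        + ENNReal.ofReal (2 * h * (t - s)) * L * (totalVariation uI 0 + totalVariation uII 0) := by
  obtain ⟨BI, hBI, hstripsI⟩ := hI.exists_finite_strips
  obtain ⟨BII, hBII, hstripsII⟩ := hII.exists_finite_strips
  have hestimate : DissipationEstimate (l1Dist uI uII) (laxDissipation (avgSpeed f uI uII) uI uII)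
      (ENNReal.ofReal (2 * h) * L * (totalVariation uI 0 + totalVariation uII 0)) s t := by
    refine .of_finite (hBI.union hBII) hst fun a b hsa hab _ hdisj => ?_
    rw [disjoint_union_right] at hdisj
    have ha : 0 ≤ a := hs.trans hsa
    obtain ⟨n, p, c, hp, hc⟩ := hstripsI a b ha hab.le hdisj.1
    obtain ⟨m, p', c', hp', hc'⟩ := hstripsII a b ha hab.le hdisj.2
    exact (hp.dissipationEstimate_of_crossings hf hh hL hC hab.le hp'
      (fun τ hτ x => hCI x τ (ha.trans hτ.1)) (fun τ hτ x => hCII x τ (ha.trans hτ.1))).mono_rate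
        (by gcongr)
  refine hestimate.trans_eq ?_
  rw [ENNReal.ofReal_mul (p := 2 * h) (by positivity)]
  ring

theorem theorem3p1 (f : ℝ → ℝ) (hf : ContDiff ℝ 2 f) (h : ℝ) (hh : 0 < h)
    (uI uII : ℝ → ℝ → ℝ)
    (hI : FrontTracking.IsFrontTracking f h uI) (hII : FrontTracking.IsFrontTracking f h uII)
    (C : Set ℝ) (hC : Convex ℝ C)
    (hCI : ∀ x t, 0 ≤ t → uI x t ∈ C) (hCII : ∀ x t, 0 ≤ t → uII x t ∈ C)
    (s t : ℝ) (hs : 0 ≤ s) (hst : s ≤ t) :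
    FrontTracking.l1Dist uI uII t
        + ∫⁻ τ in Set.Icc s t,
            FrontTracking.laxDissipation (FrontTracking.avgSpeed f uI uII) uI uII τ
      ≤ FrontTracking.l1Dist uI uII s
        + ENNReal.ofReal (2 * h * (t - s)) * (⨆ w ∈ C, ‖deriv (deriv f) w‖ₑ)
          * (FrontTracking.totalVariation uI 0 + FrontTracking.totalVariation uII 0) := by
  obtain ⟨D, L, hD, hvalues, hLip, hL⟩ :=
    FrontTracking.exists_lipschitzOnWith_deriv_of_finite hf
      (hI.finite_values.union hII.finite_values) hC
      (by rintro _ (⟨x, τ, hτ, rfl⟩ | ⟨x, τ, hτ, rfl⟩); exacts [hCI x τ hτ, hCII x τ hτ])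
  refine (theorem3p1_general (hf.differentiable two_ne_zero) hh.le hI hII hD
    (fun x τ hτ => hvalues (.inl ⟨x, τ, hτ, rfl⟩))
    (fun x τ hτ => hvalues (.inr ⟨x, τ, hτ, rfl⟩)) hLip hs hst).trans ?_
  gcongr
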